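/- **Setting (Adap DP-FL).** There are $K$ clients; client $j$ holds a finite dataset $D^j$ (a multiset of records) of size $n_j=|D^j|\ge L\ge 1$. The sampling rates $q_j=L/n_j$ and the weights $p_j=n_j/\sum_i n_i$ are public parameters of the algorithm. Given are an arbitrary training loss $\zeta(w,x)$, a measurable verification loss $J$ on $\mathbb R^d$, $w_0\in\mathbb R^d$, $\sigma_0>0$, $C_0^j>0$, a clipping factor $a>0$, $\beta\in(0,1)$, learning rates $\eta_t$, and a budget $(\epsilon,\delta)$ with $0<\delta<1$, $\epsilon\le\infty$. In round $t=0,1,\dots$ each client $j$, independently of the others, * draws a lot $L_t^j$ containing each record of its dataset independently with probability $q_j$; * uses the threshold $C_t^j$, where $C_t^j=a\,\|\tilde g_{t-1}^j\|_2$ for $t\ge1$ is computed from its noisy gradient of the previous round; * computes $\tilde g_t^j=\frac1L\Big(\sum_{x\in L_t^j} g_x/\max(1,\|g_x\|_2/C_t^j)+\mathcal N(0,\sigma_t^2(C_t^j)^2 I_d)\Big)$ with $g_x=\nabla_w\zeta(w_t,x)$, and uploads $w_{t+1}^j=w_t-\eta_t\tilde g_t^j$. The server sets $w_{t+1}=\sum_j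 p_j w_{t+1}^j$, and $\sigma_{t+1}=\beta\sigma_t$ if $J(w_{t-2})>J(w_{t-1})>J(w_t)>J(w_{t+1})$, $\sigma_{t+1}=\sigma_t$ otherwise (with $J(w_0)=J(w_1)=J(w_2)=\infty$). For an integer $\alpha\ge2$ put $$\epsilon_T^j=\sum_{t=0}^{T}\frac1{\alpha-1}\sum_{i=0}^{\alpha}\binom{\alpha}{i}(1-q_j)^{\alpha-i}q_j^{\,i}\exp\Big(\frac{i^2-i}{2\sigma_t^2}\Big)+\frac{\log(1/\delta)}{\alpha-1}.$$ Training is interrupted before the upload of round $t$ if for some client the smallest value of $\epsilon_t^j$, over a prescribed finite set of orders $\alpha$, exceeds $\epsilon$. The transcript consists of the noisy gradients $\tilde g_t^j$ of all clients in all executed rounds; all $w_t$, $w^j_t$, $C_t^j$, $\sigma_t$ are functions of it. **Theorem.** Fix a client $k$, and let $D'$ arise from the collection $D=(D^j)_j$ by adding or removing one record of $D^k$. Let $P$ and $P'$ be the laws of the transcript after $T$ rounds (or after the rounds $0,\dots,T$) when the algorithm, with the same public parameters $q_j=L/|D^j|$ and $p_j$, is run on $D$ and on $D'$. Then for every integer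 $\alpha\ge2$, client $k$ is $(\epsilon_T^k,\delta)$-differentially private: since $\epsilon_T^k$ depends on the transcript $y$ through the adaptive noise scales, this means that for every measurable set $S$ of transcripts $$P(S)<\int_S e^{\epsilon_T^k(y)}\,dP'(y)+\delta,\qquad P'(S)<\int_S e^{\epsilon_T^k(y)}\,dP(y)+\delta .$$ In particular, if $\epsilon_T^k\le\epsilon_*$ almost surely under both laws, for a constant $\epsilon_*$, then $P(S)<e^{\epsilon_*}P'(S)+\delta$ and $P'(S)<e^{\epsilon_*}P(S)+\delta$ for every measurable $S$. -/

import Mathlib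

open MeasureTheory ProbabilityTheory

noncomputable section

namespace AdapDPFL

/-! ### Differential privacy -/

/-- The two-sided `(ε, δ)` inequality for the output laws `P`, `Q` of a mechanism on two
neighbouring databases. -/
def DPBound {Y : Type*} [MeasurableSpace Y] (P Q : Measure Y) (ε δ : ℝ) : Prop :=
  ∀ S : Set Y, MeasurableSet S →
    P S < ENNReal.ofReal (Real.exp ε) * Q S + ENNReal.ofReal δ ∧
    Q S < ENNReal.ofReal (Real.exp ε) * P S + ENNReal.ofReal δ

/-- The same inequality when the privacy loss `ε` is itself read off from the output, as happens
when the noise scales are chosen adaptively: the factor `exp ε` moves inside the probability.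
For a constant `ε` this is `DPBound`. -/
def DPBoundAdaptive {Y : Type*} [MeasurableSpace Y] (P Q : Measure Y) (ε : Y → ℝ) (δ : ℝ) : Prop :=
  ∀ S : Set Y, MeasurableSet S →
    P S < ∫⁻ y in S, ENNReal.ofReal (Real.exp (ε y)) ∂Q + ENNReal.ofReal δ ∧
    Q S < ∫⁻ y in S, ENNReal.ofReal (Real.exp (ε y)) ∂P + ENNReal.ofReal δ

/-- A consistency check: for a constant loss the two notions agree. -/
theorem dpBoundAdaptive_const {Y : Type*} [MeasurableSpace Y] (P Q : Measure Y) (ε δ : ℝ) :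
    DPBoundAdaptive P Q (fun _ => ε) δ ↔ DPBound P Q ε δ := by
  simp only [DPBoundAdaptive, DPBound, setLIntegral_const]

/-- One client's dataset (a multiset of records) is obtained from another one by adding or by
removing a single record. -/
def Adjacent {X : Type*} (D D' : Multiset X) : Prop :=
  ∃ x : X, D' = x ::ₘ D ∨ D = x ::ₘ D'

/-- The datasets of all clients differ in a single record of client `k`. -/
def AdjacentAt {X : Type*} {K : ℕ} (k : Fin K) (D D' : Fin K → Multiset X) : Prop :=
  Adjacent (D k) (D' k) ∧ ∀ j, j ≠ k → D' j = D j

/-- `∑_{t=0}^T 1/(α-1) ∑_{i=0}^α C(α,i) (1-q)^(α-i) q^i exp((i²-i)/(2σ_t²)) + log(1/δ)/(α-1)`. -/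
def privacyLoss (q δ : ℝ) (σ : ℕ → ℝ) (α T : ℕ) : ℝ :=
  ∑ t ∈ Finset.range (T + 1), 1 / ((α : ℝ) - 1) *
      ∑ i ∈ Finset.range (α + 1), (α.choose i : ℝ) * (1 - q) ^ (α - i) * q ^ i *
        Real.exp (((i : ℝ) ^ 2 - i) / (2 * σ t ^ 2))
    + Real.log (1 / δ) / ((α : ℝ) - 1)

/-! ### The algorithm -/

/-- The space of model parameters. -/
abbrev Model (d : ℕ) : Type := EuclideanSpace ℝ (Fin d)

/-- Inputs of the algorithm for `K` clients, `d` model parameters and records in `X`. -/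
structure Params (K d : ℕ) (X : Type*) where
  /-- per-record training loss `ζ(w, x)` -/
  trainLoss : Model d → X → ℝ
  /-- verification loss `J` of the global model, evaluated by the server -/
  verifLoss : Model d → ℝ
  /-- initial global model `w_0` -/
  w₀ : Model d
  /-- initial clipping thresholds `C_0^k` (data-independent) -/
  C₀ : Fin K → ℝ
  /-- initial noise scale `σ_0` -/
  σ₀ : ℝ
  /-- clipping factor: the multiplier in the adaptive clipping threshold -/
  clipFactor : ℝ
  /-- noise reduction factor -/
  β : ℝ
  /-- learning rates `η_t` -/
  η : ℕ → ℝ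
  /-- group (lot) size -/
  L : ℕ
  /-- global privacy budget; the value `⊤` means that training is never interrupted -/
  budget : EReal
  /-- the second component of the global privacy budget -/
  δ : ℝ
  /-- Rényi orders with which the clients evaluate their running privacy loss (the smallest of the
  resulting values is compared with the budget) -/
  orders : Finset ℕ

/-- A transcript: `y t j` is the noisy averaged gradient of client `j` in round `t`, with `y t = 0`
for the rounds that have not been executed. Models, thresholds and noise scales are
functions of it. -/
abbrev Transcript (K d : ℕ) : Type := ℕ → Fin K → Model d

variable {K d : ℕ} {X : Type*}

/-- Gradient clipping `g / max(1, ‖g‖ / C)`, written so that it is also meaningful for `C = 0`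
(see `clip_eq`). -/
def clip (C : ℝ) (g : Model d) : Model d := min 1 (C / ‖g‖) • g

theorem clip_eq {C : ℝ} (hC : 0 < C) (g : Model d) :
    clip C g = (max 1 (‖g‖ / C))⁻¹ • g := by
  rcases eq_or_ne g 0 with rfl | hg
  · simp [clip]
  have hg' : 0 < ‖g‖ := norm_pos_iff.mpr hg
  unfold clip
  congr 1
  rcases le_total ‖g‖ C with h | h
  · rw [min_eq_left ((one_le_div hg').mpr h), max_eq_left ((div_le_one hC).mpr h), inv_one]
  · rw [min_eq_right ((div_le_one hg').mpr h), max_eq_right ((one_le_div hC).mpr h), inv_div]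

namespace Params

variable (A : Params K d X)

/-- Sampling rate `q = L / |D^k|` for a local dataset of size `n`. -/
def rate (n : ℕ) : ℝ := (A.L : ℝ) / n

/-- Local model update `w_{t+1}^k = w_t - η_t g`. -/
def localStep (t : ℕ) (w g : Model d) : Model d := w - A.η t • g

/-- Global models `w_t`: the local models are averaged with the weights `p^j = n j / ∑ i, n i`. -/
def model (n : Fin K → ℕ) (y : Transcript K d) : ℕ → Model d
  | 0 => A.w₀
  | t + 1 => ∑ j, ((n j : ℝ) / ∑ i, (n i : ℝ)) • A.localStep t (model n y t) (y t j)

/-- Clipping thresholds `C_t^j`: the clipping factor times the norm of the noisy averaged clipped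
gradient of the previous round. -/
def threshold (y : Transcript K d) (j : Fin K) : ℕ → ℝ
  | 0 => A.C₀ j
  | t + 1 => A.clipFactor * ‖y t j‖

/-- `J(w_t)`, with the convention `J(w_0) = J(w_1) = J(w_2) = ∞`. -/
def verif (n : Fin K → ℕ) (y : Transcript K d) (t : ℕ) : EReal :=
  if t ≤ 2 then ⊤ else (A.verifLoss (A.model n y t) : EReal)

open Classical in
/-- Noise scales: `σ_{t+1} = β σ_t` if `J(w_{t-2}) > J(w_{t-1}) > J(w_t) > J(w_{t+1})`, and
`σ_{t+1} = σ_t` otherwise. -/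
def noiseScale (n : Fin K → ℕ) (y : Transcript K d) : ℕ → ℝ
  | 0 => A.σ₀
  | t + 1 =>
    if 2 ≤ t ∧ A.verif n y (t - 2) > A.verif n y (t - 1) ∧ A.verif n y (t - 1) > A.verif n y t ∧
        A.verif n y t > A.verif n y (t + 1)
    then A.β * noiseScale n y t else noiseScale n y t

/-- Privacy loss of client `k` up to and including round `T`, at Rényi order `α`. It depends on the
transcript through the noise scales `σ_0, …, σ_T`. -/
def clientLoss (n : Fin K → ℕ) (k : Fin K) (α T : ℕ) (y : Transcript K d) : ℝ :=
  privacyLoss (A.rate (n k)) A.δ (A.noiseScale n y) α T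

/-- Sum of the clipped per-record gradients of a lot `s`. -/
def clippedSum (w : Model d) (C : ℝ) (s : Multiset X) : Model d :=
  (s.map fun x => clip C (gradient (fun v => A.trainLoss v x) w)).sum

/-- Law of the noisy averaged gradient `(1/L) (∑_{x ∈ s} clipped gradient + N(0, σ² C² I))` of a
client with dataset `D`, where the random lot `s` contains each record of `D` independently with
probability `q`. (`Multiset.powerset` lists sub-multisets with multiplicity.) -/
def clientLaw (q : ℝ) (w : Model d) (C σ : ℝ) (D : Multiset X) : Measure (Model d) :=
  (D.powerset.map fun s =>
    ENNReal.ofReal (q ^ s.card * (1 - q) ^ (D.card - s.card)) •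
      (stdGaussian (Model d)).map fun z =>
        (1 / (A.L : ℝ)) • (A.clippedSum w C s + (σ * C) • z)).sum

/-- Joint law of the messages of round `t`, given the transcript `y` of the earlier rounds; the
clients use independent randomness. -/
def roundLaw (n : Fin K → ℕ) (D : Fin K → Multiset X) (t : ℕ) (y : Transcript K d) :
    Measure (Fin K → Model d) :=
  Measure.pi fun j => A.clientLaw (A.rate (n j)) (A.model n y t) (A.threshold y j t)
    (A.noiseScale n y t) (D j)

/-- Training is interrupted before the upload of round `t` if the privacy loss of some client
exceeds the budget. -/
def Halted (n : Fin K → ℕ) (t : ℕ) (y : Transcript K d) : Prop :=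
  ∃ j, ∀ α ∈ A.orders, A.budget < (A.clientLoss n j α t y : EReal)

open Classical in
/-- Law of the transcript after the rounds `0, …, t - 1` on the local datasets `D`. The dataset
sizes `n`, which determine the sampling rates and the aggregation weights, are public
parameters. -/
def law (n : Fin K → ℕ) (D : Fin K → Multiset X) : ℕ → Measure (Transcript K d)
  | 0 => Measure.dirac 0
  | t + 1 => (law n D t).bind fun y =>
      if A.Halted n t y then Measure.dirac y
      else (A.roundLaw n D t y).map fun v => Function.update y t v

end Params

end AdapDPFL

end

open MeasureTheory ProbabilityTheory
open scoped ENNReal RealInnerProductSpace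

noncomputable section

namespace AdapDPFL

/-! ### Hölder-type bounds between measures: a dual form of Rényi divergence -/

section

/-! The argument is Rényi accounting in dual form. A bound on the moment of order `α` of a
likelihood ratio is replaced by the Hölder inequality it implies for all test functions
(`HolderBound`). This form passes through push-forwards, mixtures and products, and it composes over
rounds without any choice of densities for the transcript laws.

One round: conditionally on the rest of the lot, the extra record turns `N(0, I)` into `(1 - q) N(0,
I) + q N(u, I)`, up to a common affine map, with `‖u‖ ≤ 1/σ` because of clipping. Expanding the
`α`-th power of this density gives exactly the binomial sum in the privacy loss. The reverse
direction needs the moment of the inverse ratio. Reflecting and translating the Gaussian exchanges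
the likelihood ratio `r` with `1/r` at the cost of a factor `r`, and after symmetrization the
comparison is the pointwise inequality `mixture_inv_pow_add_le`. Mixing over lots and over the
unaffected clients preserves both bounds (`holderBound_clientLaw`, `holderBound_roundLaw`).

Composition (`lintegral_law_le`): the moment `M_t` of a round depends on the past through the noise
scale, so it cannot leave the integral. It is kept inside as a weight `exp (M_t / (α - 1))`; here `M
≤ exp M` suffices, although `log M` in place of `M` would be the sharp cost. The noise scale of a
round is determined by earlier messages, so the weight is constant during that round and the
induction closes.

Conversion (`law_lt`): for an indicator function the resulting bound is `δ^(1/α) I^(1/p')`, with `I`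
the integral of `exp ε` over the event and `p'` conjugate to `α`. Young's inequality bounds it by
`δ/α + I/p'`, which gives the strict inequality. -/

/-- `∫ f dP ≤ m^(1/p) (∫ f^q dQ)^(1/q)` for all measurable `f ≥ 0`. For conjugate exponents this is
the dual formulation of `∫ (dP/dQ)^p dQ ≤ m`, a bound on the Rényi divergence of order `p`. -/
def HolderBound {Y : Type*} [MeasurableSpace Y] (p q : ℝ) (m : ℝ≥0∞) (P Q : Measure Y) : Prop :=
  ∀ f : Y → ℝ≥0∞, Measurable f →
    ∫⁻ y, f y ∂P ≤ m ^ (1 / p) * (∫⁻ y, f y ^ q ∂Q) ^ (1 / q)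

/-- Hölder's inequality for sums of two terms. It makes the bounds additive in the pair of measures,
hence stable under mixtures. -/
theorem rpow_mul_rpow_add_le {p q : ℝ} (hpq : p.HolderConjugate q) (a b c d : ℝ≥0∞) :
    a ^ (1 / p) * c ^ (1 / q) + b ^ (1 / p) * d ^ (1 / q) ≤
      (a + b) ^ (1 / p) * (c + d) ^ (1 / q) := by
  have h := ENNReal.inner_le_Lp_mul_Lq Finset.univ ![a ^ (1 / p), b ^ (1 / p)]
    ![c ^ (1 / q), d ^ (1 / q)] hpq
  have key : ∀ x : ℝ≥0∞, ∀ s : ℝ, s ≠ 0 → (x ^ (1 / s)) ^ s = x := fun x s hs => by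
    rw [← ENNReal.rpow_mul, one_div_mul_cancel hs, ENNReal.rpow_one]
  simpa [Fin.sum_univ_two, key, ← one_div, hpq.pos.ne', hpq.symm.pos.ne'] using h

namespace HolderBound

variable {Y Z : Type*} [MeasurableSpace Y] [MeasurableSpace Z] {p q : ℝ} {m m' : ℝ≥0∞}
  {P Q P' Q' : Measure Y}

theorem mono (hpq : p.HolderConjugate q) (h : HolderBound p q m P Q) (hm : m ≤ m') :
    HolderBound p q m' P Q := fun f hf =>
  (h f hf).trans (by have := hpq.pos; gcongr)

theorem map (h : HolderBound p q m P Q) {g : Y → Z} (hg : Measurable g) :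
    HolderBound p q m (P.map g) (Q.map g) := fun f hf => by
  rw [lintegral_map hf hg, lintegral_map (hf.pow_const _) hg]
  exact h _ (hf.comp hg)

theorem smul (hpq : p.HolderConjugate q) (h : HolderBound p q m P Q) (c : ℝ≥0∞) :
    HolderBound p q (c * m) (c • P) (c • Q) := fun f hf => by
  rw [lintegral_smul_measure, lintegral_smul_measure, smul_eq_mul, smul_eq_mul,
    ENNReal.mul_rpow_of_nonneg _ _ (one_div_nonneg.2 hpq.nonneg),
    ENNReal.mul_rpow_of_nonneg _ _ (one_div_nonneg.2 hpq.symm.nonneg)]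
  have hc : c = c ^ (1 / p) * c ^ (1 / q) := by
    rw [← ENNReal.rpow_add_of_nonneg _ _ (one_div_nonneg.2 hpq.nonneg)
      (one_div_nonneg.2 hpq.symm.nonneg), one_div, one_div, hpq.inv_add_inv_eq_one,
      ENNReal.rpow_one]
  calc c * ∫⁻ y, f y ∂P
      ≤ (c ^ (1 / p) * c ^ (1 / q)) * (m ^ (1 / p) * (∫⁻ y, f y ^ q ∂Q) ^ (1 / q)) :=
        mul_le_mul' hc.le (h f hf)
    _ = _ := by ring

theorem add (hpq : p.HolderConjugate q) (h : HolderBound p q m P Q)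
    (h' : HolderBound p q m' P' Q') : HolderBound p q (m + m') (P + P') (Q + Q') :=
  fun f hf => by
    rw [lintegral_add_measure, lintegral_add_measure]
    exact (add_le_add (h f hf) (h' f hf)).trans (rpow_mul_rpow_add_le hpq _ _ _ _)

theorem zero : HolderBound p q m (0 : Measure Y) Q := fun f _ => by simp

theorem multiset_sum (hpq : p.HolderConjugate q) {ι : Type*} (S : Multiset ι) (c : ι → ℝ≥0∞)
    (P Q : ι → Measure Y) (h : ∀ s ∈ S, HolderBound p q (c s) (P s) (Q s)) :
    HolderBound p q (S.map c).sum (S.map P).sum (S.map Q).sum := by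
  induction S using Multiset.induction_on with
  | empty => simpa using zero
  | cons a S ih =>
    simp only [Multiset.map_cons, Multiset.sum_cons]
    exact (h a (Multiset.mem_cons_self a S)).add hpq
      (ih fun s hs => h s (Multiset.mem_cons_of_mem hs))

/-- Hölder against the constant function `1`; for a probability measure this is Jensen's inequality
for the concave power `1 / q`. -/
theorem lintegral_rpow_le (hpq : p.HolderConjugate q) (μ : Measure Y) {g : Y → ℝ≥0∞}
    (hg : AEMeasurable g μ) :
    ∫⁻ y, g y ^ (1 / q) ∂μ ≤ μ Set.univ ^ (1 / p) * (∫⁻ y, g y ∂μ) ^ (1 / q) := by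
  have h := ENNReal.lintegral_mul_le_Lp_mul_Lq μ hpq (f := fun _ => 1)
    (g := fun y => g y ^ (1 / q)) aemeasurable_const (hg.pow_const _)
  have key : ∀ x : ℝ≥0∞, (x ^ (1 / q)) ^ q = x := fun x => by
    rw [← ENNReal.rpow_mul, one_div_mul_cancel hpq.symm.pos.ne', ENNReal.rpow_one]
  simpa only [Pi.mul_apply, one_mul, ENNReal.one_rpow, lintegral_const, key] using h

theorem refl (hpq : p.HolderConjugate q) (P : Measure Y) : HolderBound p q (P Set.univ) P P :=
  fun f hf => by
    have h := lintegral_rpow_le hpq P (hf.pow_const q).aemeasurable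
    simpa only [← ENNReal.rpow_mul, mul_one_div_cancel hpq.symm.pos.ne', ENNReal.rpow_one] using h

/-- An independent common factor costs nothing: the bound is applied on each slice, and the
concavity of the power `1 / q` then moves it outside the integral over the common factor. -/
theorem prod_left (hpq : p.HolderConjugate q) (h : HolderBound p q m P Q) (μ : Measure Z)
    [IsProbabilityMeasure μ] [SFinite P] [SFinite Q] :
    HolderBound p q m (P.prod μ) (Q.prod μ) := fun f hf => by
  rw [lintegral_prod_symm _ hf.aemeasurable, lintegral_prod_symm _ (hf.pow_const _).aemeasurable]
  have hm : Measurable fun z => ∫⁻ y, f (y, z) ^ q ∂Q :=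
    (hf.pow_const q).lintegral_prod_left'
  calc ∫⁻ z, ∫⁻ y, f (y, z) ∂P ∂μ
      ≤ ∫⁻ z, m ^ (1 / p) * (∫⁻ y, f (y, z) ^ q ∂Q) ^ (1 / q) ∂μ :=
        lintegral_mono fun z => h _ (hf.comp measurable_prodMk_right)
    _ = m ^ (1 / p) * ∫⁻ z, (∫⁻ y, f (y, z) ^ q ∂Q) ^ (1 / q) ∂μ :=
        lintegral_const_mul _ (hm.pow_const _)
    _ ≤ m ^ (1 / p) * (1 * (∫⁻ z, ∫⁻ y, f (y, z) ^ q ∂Q ∂μ) ^ (1 / q)) := by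
        gcongr
        simpa using lintegral_rpow_le hpq μ hm.aemeasurable
    _ = _ := by rw [one_mul]

/-- Changing one factor of a product of probability measures. -/
theorem pi (hpq : p.HolderConjugate q) {K : ℕ} (k : Fin K) (μ ν : Fin K → Measure Y)
    [∀ j, IsProbabilityMeasure (μ j)] [∀ j, IsProbabilityMeasure (ν j)]
    (h : HolderBound p q m (μ k) (ν k)) (hne : ∀ j, j ≠ k → μ j = ν j) :
    HolderBound p q m (Measure.pi μ) (Measure.pi ν) := by
  cases K with
  | zero => exact k.elim0
  | succ K =>
    rw [← (measurePreserving_piFinSuccAbove μ k).symm.map_eq,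
      ← (measurePreserving_piFinSuccAbove ν k).symm.map_eq]
    have e : (fun j => ν (k.succAbove j)) = fun j => μ (k.succAbove j) :=
      funext fun j => (hne _ (Fin.succAbove_ne k j)).symm
    rw [e]
    exact (h.prod_left hpq _).map (MeasurableEquiv.measurable _)

/-- The passage from a genuine moment bound on a likelihood ratio to its dual form, by Hölder's
inequality. -/
theorem withDensity (hpq : p.HolderConjugate q) (Q : Measure Y) {ρ : Y → ℝ≥0∞}
    (hρ : Measurable ρ) (hm : ∫⁻ y, ρ y ^ p ∂Q ≤ m) :
    HolderBound p q m (Q.withDensity ρ) Q := fun f hf => by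
  rw [lintegral_withDensity_eq_lintegral_mul _ hρ hf]
  refine (ENNReal.lintegral_mul_le_Lp_mul_Lq Q hpq hρ.aemeasurable hf.aemeasurable).trans ?_
  have := hpq.pos
  gcongr

end HolderBound

end

section

/-! ### An elementary inequality -/

/-- Induction on `n`. With `X = a^(n+1)` and `B = b^(n+1)`, the gap between the two sides grows from
`n` to `n + 1` by `(a - 1) ((X + X⁻¹) - (B + B⁻¹))`, the relation between `a`, `b` and `r` having
been used to replace `r (1 - b)`. -/
theorem inv_pow_add_le_of_one_le {a b r : ℝ} (ha : 1 ≤ a) (hb : 0 < b) (hb1 : b ≤ 1)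
    (hab : 1 ≤ a * b) (h : a - 1 = r * (1 - b)) (n : ℕ) :
    (a ^ n)⁻¹ + r * (b ^ n)⁻¹ ≤ a ^ (n + 1) + r * b ^ (n + 1) := by
  have ha0 : 0 < a := by linarith
  induction n with
  | zero => simp; linarith
  | succ n ih =>
    set X := a ^ (n + 1) with hX
    set B := b ^ (n + 1) with hB
    have hX1 : 1 ≤ X := one_le_pow₀ ha
    have hB0 : 0 < B := pow_pos hb _
    have hB1 : B ≤ 1 := pow_le_one₀ hb.le hb1
    have hXB : 1 ≤ X * B := by rw [hX, hB, ← mul_pow]; exact one_le_pow₀ hab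
    have hX0 : 0 < X := by linarith
    -- Since `X ≥ B⁻¹ ≥ 1`, this is the monotonicity of `x + x⁻¹` on `[1, ∞)`.
    have hmono : B + B⁻¹ ≤ X + X⁻¹ := by
      have e : X + X⁻¹ - (B + B⁻¹) = (X * B - 1) * (B⁻¹ - X⁻¹) := by
        field_simp; ring
      have : X⁻¹ ≤ B⁻¹ := inv_anti₀ hB0 (hB1.trans hX1)
      have := mul_nonneg (sub_nonneg.2 hXB) (sub_nonneg.2 this)
      linarith
    have hstep := mul_le_mul_of_nonneg_left hmono (sub_nonneg.2 ha)
    have e1 : (a ^ n)⁻¹ = a * X⁻¹ := by rw [hX, pow_succ]; field_simp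
    have e2 : (b ^ n)⁻¹ = b * B⁻¹ := by rw [hB, pow_succ]; field_simp
    have e3 : a ^ (n + 1 + 1) = a * X := by rw [hX]; ring
    have e4 : b ^ (n + 1 + 1) = b * B := by rw [hB]; ring
    rw [e1, e2] at ih
    rw [e3, e4]
    have e5 : (a - 1) * (B + B⁻¹) = r * (1 - b) * (B + B⁻¹) := by rw [h]
    linarith

theorem inv_pow_add_le {a b r : ℝ} (ha : 0 < a) (hb : 0 < b) (hr : 0 < r)
    (hab : 1 ≤ a * b) (h : a + r * b = 1 + r) (n : ℕ) :
    (a ^ n)⁻¹ + r * (b ^ n)⁻¹ ≤ a ^ (n + 1) + r * b ^ (n + 1) := by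
  rcases le_total 1 a with h1 | h1
  · refine inv_pow_add_le_of_one_le h1 hb ?_ hab (by linarith) n
    by_contra! hb1
    have := mul_lt_mul_of_pos_left hb1 hr
    linarith
  -- The hypotheses are symmetric under exchanging `a` with `b` and `r` with `r⁻¹`, which reduces
  -- this case to the previous lemma.
  · have hb1 : 1 ≤ b := by
      by_contra! hb1
      have := mul_lt_mul_of_pos_left hb1 hr
      linarith
    have := inv_pow_add_le_of_one_le (r := r⁻¹) hb1 ha h1 (by rwa [mul_comm])
      (by field_simp; linarith) n
    have := mul_le_mul_of_nonneg_left this hr.le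
    rw [mul_add, mul_add, mul_inv_cancel_left₀ hr.ne', mul_inv_cancel_left₀ hr.ne'] at this
    linarith

/-- The two bases `a`, `b` are the mixture density at likelihood ratios `r` and `r⁻¹`. They satisfy
`a + r b = 1 + r`, and `a b ≥ 1` because `r + r⁻¹ ≥ 2`. -/
theorem mixture_inv_pow_add_le {q r : ℝ} (hq : 0 ≤ q) (hq1 : q ≤ 1) (hr : 0 < r) (n : ℕ) :
    ((1 - q + q * r) ^ n)⁻¹ + r * ((1 - q + q * r⁻¹) ^ n)⁻¹ ≤
      (1 - q + q * r) ^ (n + 1) + r * (1 - q + q * r⁻¹) ^ (n + 1) := by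
  have pos : ∀ x : ℝ, 0 < x → 0 < 1 - q + q * x := fun x hx => by
    rcases hq.eq_or_lt with rfl | h
    · simp
    · have := mul_pos h hx; linarith
  refine inv_pow_add_le (pos r hr) (pos _ (inv_pos.2 hr)) hr ?_ (by field_simp; ring) n
  have h2 : 2 ≤ r + r⁻¹ := by
    have : r + r⁻¹ - 2 = (r - 1) ^ 2 * r⁻¹ := by field_simp; ring
    have := mul_nonneg (sq_nonneg (r - 1)) (inv_pos.2 hr).le
    linarith
  have e : (1 - q + q * r) * (1 - q + q * r⁻¹) = 1 + q * (1 - q) * (r + r⁻¹ - 2) := by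
    field_simp; ring
  rw [e]
  have := mul_nonneg (mul_nonneg hq (sub_nonneg.2 hq1)) (sub_nonneg.2 h2)
  linarith

/-! ### Translates of the standard Gaussian -/

theorem pi_withDensity {ι : Type*} [Fintype ι] {Y : ι → Type*} [∀ i, MeasurableSpace (Y i)]
    (μ : ∀ i, Measure (Y i)) [∀ i, IsProbabilityMeasure (μ i)] (f : ∀ i, Y i → ℝ≥0∞)
    (hf : ∀ i, Measurable (f i)) [∀ i, SigmaFinite ((μ i).withDensity (f i))] :
    Measure.pi (fun i => (μ i).withDensity (f i)) =
      (Measure.pi μ).withDensity fun x => ∏ i, f i (x i) := by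
  refine Measure.pi_eq fun s hs => ?_
  have hm : ∀ i, Measurable ((s i).indicator (f i)) := fun i => (hf i).indicator (hs i)
  rw [withDensity_apply _ (MeasurableSet.univ_pi hs), ← lintegral_indicator (.univ_pi hs)]
  have e : (Set.univ.pi s).indicator (fun x : ∀ i, Y i => ∏ i, f i (x i)) =
      fun x => ∏ i, (s i).indicator (f i) (x i) := by
    funext x
    by_cases hx : x ∈ Set.univ.pi s
    · rw [Set.indicator_of_mem hx]
      exact Finset.prod_congr rfl fun i _ =>
        (Set.indicator_of_mem (hx i (Set.mem_univ i)) _).symm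
    · rw [Set.indicator_of_notMem hx]
      simp only [Set.mem_pi, Set.mem_univ, true_implies, not_forall] at hx
      obtain ⟨i, hi⟩ := hx
      exact (Finset.prod_eq_zero (Finset.mem_univ i) (Set.indicator_of_notMem hi _)).symm
  rw [e, lintegral_prod_eq_prod_lintegral_of_indepFun Finset.univ
    (fun i (x : ∀ i, Y i) => (s i).indicator (f i) (x i))
    (iIndepFun_pi fun i => (hm i).aemeasurable) fun i => (hm i).comp (measurable_pi_apply i)]
  refine Finset.prod_congr rfl fun i _ => ?_
  rw [(measurePreserving_eval μ i).lintegral_comp (hm i), lintegral_indicator (hs i),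
    withDensity_apply _ (hs i)]

theorem gaussianReal_eq_withDensity (t : ℝ) :
    gaussianReal t 1 =
      (gaussianReal 0 1).withDensity fun x => ENNReal.ofReal (Real.exp (t * x - t ^ 2 / 2)) := by
  rw [gaussianReal_of_var_ne_zero _ one_ne_zero, gaussianReal_of_var_ne_zero _ one_ne_zero,
    ← withDensity_mul _ (measurable_gaussianPDF 0 1) (by fun_prop)]
  congr 1
  funext x
  rw [Pi.mul_apply, gaussianPDF, gaussianPDF,
    ← ENNReal.ofReal_mul (gaussianPDFReal_nonneg _ _ _), gaussianPDFReal, gaussianPDFReal,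
    mul_assoc _ (Real.exp _) (Real.exp _), ← Real.exp_add]
  congr 3
  simp
  ring

variable {d : ℕ}

/-- Density of `N(u, I)` with respect to `N(0, I)`. -/
def shiftDensity (u z : Model d) : ℝ := Real.exp (⟪u, z⟫ - ‖u‖ ^ 2 / 2)

theorem shiftDensity_pos (u z : Model d) : 0 < shiftDensity u z := Real.exp_pos _

@[fun_prop]
theorem measurable_shiftDensity (u : Model d) : Measurable (shiftDensity u) := by
  unfold shiftDensity; fun_prop

/-- The Cameron–Martin formula in finite dimension, obtained by multiplying the one-dimensional
densities over the coordinates. -/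
theorem stdGaussian_map_add (u : Model d) :
    (stdGaussian (Model d)).map (fun z => z + u) =
      (stdGaussian (Model d)).withDensity fun z => ENNReal.ofReal (shiftDensity u z) := by
  have hpi : (Measure.pi fun _ : Fin d => gaussianReal 0 1).map (fun x i => x i + u i) =
      (Measure.pi fun _ : Fin d => gaussianReal 0 1).withDensity
        fun x => ENNReal.ofReal (shiftDensity u (WithLp.toLp 2 x)) := by
    have h : ∀ i, (gaussianReal 0 1).map (fun x => x + u i) = (gaussianReal 0 1).withDensity
        fun x => ENNReal.ofReal (Real.exp (u i * x - u i ^ 2 / 2)) := fun i => by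
      rw [gaussianReal_map_add_const, zero_add, gaussianReal_eq_withDensity]
    have hp : ∀ i, IsProbabilityMeasure ((gaussianReal 0 1).map (fun x => x + u i)) := fun i =>
      Measure.isProbabilityMeasure_map (by fun_prop)
    have hp' : ∀ i, IsProbabilityMeasure ((gaussianReal 0 1).withDensity
        fun x => ENNReal.ofReal (Real.exp (u i * x - u i ^ 2 / 2))) := fun i => by
      rw [← h i]; exact hp i
    rw [Measure.pi_map_pi (f := fun i x => x + u i) (by fun_prop)]
    simp_rw [h]
    rw [pi_withDensity _ _ (by fun_prop)]
    congr 1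
    funext x
    rw [← ENNReal.ofReal_prod_of_nonneg fun i _ => (Real.exp_pos _).le, ← Real.exp_sum,
      shiftDensity, EuclideanSpace.real_norm_sq_eq, Finset.sum_sub_distrib, Finset.sum_div]
    simp [PiLp.inner_apply, mul_comm]
  refine Measure.ext_of_lintegral _ fun φ hφ => ?_
  have hT : Measurable (WithLp.toLp 2 : (Fin d → ℝ) → Model d) := by fun_prop
  rw [← map_pi_eq_stdGaussian, lintegral_withDensity_eq_lintegral_mul _ (by fun_prop) hφ,
    lintegral_map hφ (by fun_prop), lintegral_map (by fun_prop) hT, lintegral_map (by fun_prop) hT]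
  have := congrArg (fun μ => ∫⁻ x, φ (WithLp.toLp 2 x) ∂μ) hpi
  simp only at this
  rw [lintegral_map (by fun_prop) (by fun_prop),
    lintegral_withDensity_eq_lintegral_mul _ (by fun_prop) (by fun_prop)] at this
  exact this

theorem lintegral_shiftDensity (u : Model d) :
    ∫⁻ z, ENNReal.ofReal (shiftDensity u z) ∂(stdGaussian (Model d)) = 1 := by
  have h := congrArg (fun μ => μ Set.univ) (stdGaussian_map_add u)
  have : IsProbabilityMeasure ((stdGaussian (Model d)).map (fun z => z + u)) :=
    Measure.isProbabilityMeasure_map (by fun_prop)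
  simp only [measure_univ, withDensity_apply _ MeasurableSet.univ, Measure.restrict_univ] at h
  exact h.symm

/-- Completing the square: a power of the density is a constant times the density of a longer shift,
which integrates to `1`. This produces the exponent `i² - i`. -/
theorem shiftDensity_pow (u z : Model d) (i : ℕ) :
    shiftDensity u z ^ i =
      Real.exp (((i : ℝ) ^ 2 - i) * (‖u‖ ^ 2 / 2)) * shiftDensity ((i : ℝ) • u) z := by
  rw [shiftDensity, shiftDensity, ← Real.exp_nat_mul, ← Real.exp_add, real_inner_smul_left,
    norm_smul, mul_pow, Real.norm_natCast]
  congr 1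
  ring

theorem lintegral_shiftDensity_pow (u : Model d) (i : ℕ) :
    ∫⁻ z, ENNReal.ofReal (shiftDensity u z ^ i) ∂(stdGaussian (Model d)) =
      ENNReal.ofReal (Real.exp (((i : ℝ) ^ 2 - i) * (‖u‖ ^ 2 / 2))) := by
  simp_rw [shiftDensity_pow, ENNReal.ofReal_mul (Real.exp_pos _).le]
  rw [lintegral_const_mul _ (by fun_prop), lintegral_shiftDensity, mul_one]

/-- The map `z ↦ u - z` exchanges `N(0, I)` and `N(u, I)` and inverts their likelihood ratio. -/
theorem lintegral_shiftDensity_symm (u : Model d) {F : ℝ → ℝ≥0∞} (hF : Measurable F) :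
    ∫⁻ z, F (shiftDensity u z) ∂(stdGaussian (Model d)) =
      ∫⁻ z, ENNReal.ofReal (shiftDensity u z) * F (shiftDensity u z)⁻¹
        ∂(stdGaussian (Model d)) := by
  have hneg : (stdGaussian (Model d)).map (fun z => -z) = stdGaussian (Model d) :=
    stdGaussian_map (LinearIsometryEquiv.neg ℝ)
  have hpt : ∀ z, (shiftDensity u (z + u))⁻¹ = shiftDensity u (-z) := fun z => by
    rw [shiftDensity, shiftDensity, ← Real.exp_neg, inner_add_right, inner_neg_right,
      real_inner_self_eq_norm_sq]
    congr 1; ring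
  have hG : Measurable fun z => F (shiftDensity u z)⁻¹ := by fun_prop
  calc ∫⁻ z, F (shiftDensity u z) ∂(stdGaussian (Model d))
      = ∫⁻ z, F (shiftDensity u (-z)) ∂(stdGaussian (Model d)) := by
        conv_lhs => rw [← hneg]
        rw [lintegral_map (by fun_prop) (by fun_prop)]
    _ = ∫⁻ z, F (shiftDensity u z)⁻¹ ∂((stdGaussian (Model d)).map (fun z => z + u)) := by
        rw [lintegral_map hG (by fun_prop)]
        simp_rw [hpt]
    _ = _ := by
        rw [stdGaussian_map_add, lintegral_withDensity_eq_lintegral_mul _ (by fun_prop) hG]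
        rfl

/-! ### The sampled Gaussian mechanism -/

/-- The `α`-th moment of the likelihood ratio of `(1 - q) N(0, I) + q N(u, I)` with respect to
`N(0, I)`, where `c = ‖u‖² / 2`. -/
def sampledMoment (q c : ℝ) (α : ℕ) : ℝ :=
  ∑ i ∈ Finset.range (α + 1), (α.choose i : ℝ) * (1 - q) ^ (α - i) * q ^ i *
    Real.exp (((i : ℝ) ^ 2 - i) * c)

theorem sampledMoment_nonneg {q : ℝ} (hq : 0 ≤ q) (hq1 : q ≤ 1) (c : ℝ) (α : ℕ) :
    0 ≤ sampledMoment q c α := by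
  have := sub_nonneg.2 hq1
  unfold sampledMoment
  positivity

theorem sampledMoment_mono {q c c' : ℝ} (hq : 0 ≤ q) (hq1 : q ≤ 1) (h : c ≤ c') (α : ℕ) :
    sampledMoment q c α ≤ sampledMoment q c' α := by
  have := sub_nonneg.2 hq1
  refine Finset.sum_le_sum fun i _ => mul_le_mul_of_nonneg_left ?_ (by positivity)
  have hi : (0 : ℝ) ≤ (i : ℝ) ^ 2 - i := by
    rcases Nat.eq_zero_or_pos i with rfl | hi
    · simp
    · have : (1 : ℝ) ≤ i := by exact_mod_cast hi
      nlinarith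
  exact Real.exp_le_exp.2 (mul_le_mul_of_nonneg_left h hi)

theorem one_le_sampledMoment {q c : ℝ} (hq : 0 ≤ q) (hq1 : q ≤ 1) (hc : 0 ≤ c) (α : ℕ) :
    1 ≤ sampledMoment q c α := by
  refine le_trans (le_of_eq ?_) (sampledMoment_mono hq hq1 hc α)
  have h := add_pow q (1 - q) α
  rw [add_sub_cancel, one_pow] at h
  rw [h, sampledMoment]
  refine Finset.sum_congr rfl fun i _ => ?_
  rw [mul_zero, Real.exp_zero]
  ring

variable {q : ℝ}

theorem mixture_pos (hq : 0 ≤ q) (hq1 : q ≤ 1) (u z : Model d) :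
    0 < 1 - q + q * shiftDensity u z := by
  rcases hq.eq_or_lt with rfl | h
  · simp
  · have := mul_pos h (shiftDensity_pos u z); linarith

theorem lintegral_mixture_pow (hq : 0 ≤ q) (hq1 : q ≤ 1) (u : Model d) (α : ℕ) :
    ∫⁻ z, ENNReal.ofReal ((1 - q + q * shiftDensity u z) ^ α) ∂(stdGaussian (Model d)) =
      ENNReal.ofReal (sampledMoment q (‖u‖ ^ 2 / 2) α) := by
  have h1 := sub_nonneg.2 hq1
  have e : ∀ z, (1 - q + q * shiftDensity u z) ^ α = ∑ i ∈ Finset.range (α + 1),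
      (α.choose i : ℝ) * (1 - q) ^ (α - i) * q ^ i * shiftDensity u z ^ i := fun z => by
    rw [add_comm, add_pow]
    refine Finset.sum_congr rfl fun i _ => ?_
    rw [mul_pow]; ring
  have hc : ∀ i, 0 ≤ (α.choose i : ℝ) * (1 - q) ^ (α - i) * q ^ i := fun i => by positivity
  simp_rw [e]
  rw [sampledMoment, ENNReal.ofReal_sum_of_nonneg fun i _ => mul_nonneg (hc i) (Real.exp_pos _).le]
  simp_rw [ENNReal.ofReal_sum_of_nonneg fun i _ =>
    mul_nonneg (hc i) (pow_nonneg (shiftDensity_pos u _).le _)]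
  rw [lintegral_finsetSum _ (by fun_prop)]
  refine Finset.sum_congr rfl fun i _ => ?_
  simp_rw [ENNReal.ofReal_mul (hc i)]
  rw [lintegral_const_mul _ (by fun_prop), lintegral_shiftDensity_pow]

/-- The integrands are not comparable pointwise. They become so after averaging each with its image
under the symmetry `r ↦ 1/r`. -/
theorem lintegral_mixture_inv_pow_le (hq : 0 ≤ q) (hq1 : q ≤ 1) (u : Model d) (n : ℕ) :
    ∫⁻ z, ENNReal.ofReal ((1 - q + q * shiftDensity u z) ^ n)⁻¹ ∂(stdGaussian (Model d)) ≤
      ENNReal.ofReal (sampledMoment q (‖u‖ ^ 2 / 2) (n + 1)) := by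
  have h1 := sub_nonneg.2 hq1
  rw [← lintegral_mixture_pow hq hq1]
  have key : ∀ F : ℝ → ℝ, Measurable F → (∀ x, 0 < x → 0 ≤ F x) →
      2 * ∫⁻ z, ENNReal.ofReal (F (shiftDensity u z)) ∂(stdGaussian (Model d)) =
      ∫⁻ z, ENNReal.ofReal (F (shiftDensity u z) + shiftDensity u z * F (shiftDensity u z)⁻¹)
        ∂(stdGaussian (Model d)) := fun F hF hF0 => by
    rw [two_mul]
    nth_rewrite 2 [lintegral_shiftDensity_symm u (F := fun x => ENNReal.ofReal (F x))
      (by fun_prop)]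
    rw [← lintegral_add_left (by fun_prop)]
    refine lintegral_congr fun z => ?_
    have hr := shiftDensity_pos u z
    rw [← ENNReal.ofReal_mul hr.le, ← ENNReal.ofReal_add (hF0 _ hr)
      (mul_nonneg hr.le (hF0 _ (inv_pos.2 hr)))]
  have h := lintegral_mono (μ := stdGaussian (Model d)) fun z =>
    ENNReal.ofReal_le_ofReal (mixture_inv_pow_add_le hq hq1 (shiftDensity_pos u z) n)
  rw [← key (fun x => ((1 - q + q * x) ^ n)⁻¹) (by fun_prop) fun x hx => by positivity,
    ← key (fun x => (1 - q + q * x) ^ (n + 1)) (by fun_prop) fun x hx => by positivity] at h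
  exact (ENNReal.mul_le_mul_iff_right two_ne_zero ENNReal.ofNat_ne_top).1 h

theorem mixture_eq_withDensity (hq : 0 ≤ q) (hq1 : q ≤ 1) (u : Model d) :
    ENNReal.ofReal (1 - q) • stdGaussian (Model d) +
        ENNReal.ofReal q • (stdGaussian (Model d)).map (fun z => z + u) =
      (stdGaussian (Model d)).withDensity
        fun z => ENNReal.ofReal (1 - q + q * shiftDensity u z) := by
  rw [stdGaussian_map_add, ← withDensity_const, ← withDensity_smul _ (by fun_prop),
    ← withDensity_add_left (by fun_prop)]
  congr 1
  funext z
  rw [ENNReal.ofReal_add (sub_nonneg.2 hq1) (mul_nonneg hq (shiftDensity_pos u z).le),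
    ENNReal.ofReal_mul hq]
  rfl

variable {p' : ℝ} {α : ℕ}

theorem holderBound_mixture_stdGaussian (hα : (α : ℝ).HolderConjugate p') (hq : 0 ≤ q)
    (hq1 : q ≤ 1) (u : Model d) :
    HolderBound α p' (ENNReal.ofReal (sampledMoment q (‖u‖ ^ 2 / 2) α))
      (ENNReal.ofReal (1 - q) • stdGaussian (Model d) +
        ENNReal.ofReal q • (stdGaussian (Model d)).map (fun z => z + u))
      (stdGaussian (Model d)) := by
  rw [mixture_eq_withDensity hq hq1]
  refine HolderBound.withDensity hα _ (by fun_prop) ?_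
  rw [← lintegral_mixture_pow hq hq1]
  refine (lintegral_congr fun z => ?_).le
  rw [ENNReal.rpow_natCast, ENNReal.ofReal_pow (mixture_pos hq hq1 u z).le]

/-- With the mixture as reference measure the likelihood ratio is the inverse of the mixture density
`ρ`. Its `α`-th moment is `∫ ρ^(1 - α)` under the Gaussian, so the exponent drops from `α = n + 1`
to `n`. -/
theorem holderBound_stdGaussian_mixture (hα : (α : ℝ).HolderConjugate p') (hq : 0 ≤ q)
    (hq1 : q ≤ 1) (u : Model d) :
    HolderBound α p' (ENNReal.ofReal (sampledMoment q (‖u‖ ^ 2 / 2) α))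
      (stdGaussian (Model d))
      (ENNReal.ofReal (1 - q) • stdGaussian (Model d) +
        ENNReal.ofReal q • (stdGaussian (Model d)).map (fun z => z + u)) := by
  obtain ⟨n, rfl⟩ : ∃ n, α = n + 1 := Nat.exists_eq_succ_of_ne_zero (by
    rintro rfl; simpa using hα.pos)
  have hm : Measurable fun z : Model d => ENNReal.ofReal (1 - q + q * shiftDensity u z) := by
    fun_prop
  rw [mixture_eq_withDensity hq hq1]
  have e : stdGaussian (Model d) = ((stdGaussian (Model d)).withDensity
      fun z => ENNReal.ofReal (1 - q + q * shiftDensity u z)).withDensity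
        fun z => ENNReal.ofReal (1 - q + q * shiftDensity u z)⁻¹ := by
    rw [← withDensity_mul _ hm (by fun_prop)]
    conv_lhs => rw [← withDensity_one (μ := stdGaussian (Model d))]
    congr 1
    funext z
    have := mixture_pos hq hq1 u z
    rw [Pi.mul_apply, ← ENNReal.ofReal_mul this.le, mul_inv_cancel₀ this.ne']
    simp
  nth_rewrite 1 [e]
  refine HolderBound.withDensity hα _ (by fun_prop) ?_
  rw [lintegral_withDensity_eq_lintegral_mul _ hm (by fun_prop)]
  refine le_trans (lintegral_congr fun z => ?_).le (lintegral_mixture_inv_pow_le hq hq1 u n)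
  have := mixture_pos hq hq1 u z
  rw [Pi.mul_apply, ENNReal.rpow_natCast, ← ENNReal.ofReal_pow (inv_pos.2 this).le,
    ← ENNReal.ofReal_mul this.le]
  congr 1
  rw [pow_succ', inv_pow, mul_inv_cancel_left₀ this.ne']

end

/-! ### One client in one round: clipping, random lots and the effect of one record -/

section

variable {K d : ℕ} {X : Type*}

theorem norm_clip_le {C : ℝ} (hC : 0 ≤ C) (g : Model d) : ‖clip C g‖ ≤ C := by
  rcases eq_or_ne g 0 with rfl | hg
  · simpa [clip] using hC
  have hg' : 0 < ‖g‖ := norm_pos_iff.mpr hg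
  rw [clip, norm_smul, Real.norm_of_nonneg (le_min zero_le_one (by positivity))]
  calc min 1 (C / ‖g‖) * ‖g‖ ≤ C / ‖g‖ * ‖g‖ := by gcongr; exact min_le_right _ _
    _ = C := by field_simp

theorem multiset_sum_measure_apply {Y ι : Type*} [MeasurableSpace Y] (S : Multiset ι)
    (μ : ι → Measure Y) (s : Set Y) : (S.map μ).sum s = (S.map fun i => μ i s).sum := by
  induction S using Multiset.induction_on with
  | empty => simp
  | cons a S ih => simp [ih]

theorem measurable_multiset_sum {Y ι : Type*} [MeasurableSpace Y] (S : Multiset ι)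
    (f : ι → Y → ℝ≥0∞) (hf : ∀ i, Measurable (f i)) :
    Measurable fun y => (S.map fun i => f i y).sum := by
  induction S using Multiset.induction_on with
  | empty => simp
  | cons a S ih =>
    simp only [Multiset.map_cons, Multiset.sum_cons]
    exact (hf a).add ih

/-- Split a sum over lots according to whether the record `x` is sampled. -/
theorem sum_powerset_cons {M : Type*} [AddCommMonoid M] [Module ℝ≥0∞ M] {q : ℝ} (hq : 0 ≤ q)
    (hq1 : q ≤ 1) (x : X) (D : Multiset X) (F : Multiset X → M) :
    ((x ::ₘ D).powerset.map fun s =>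
        ENNReal.ofReal (q ^ s.card * (1 - q) ^ ((x ::ₘ D).card - s.card)) • F s).sum =
      (D.powerset.map fun s => ENNReal.ofReal (q ^ s.card * (1 - q) ^ (D.card - s.card)) •
        (ENNReal.ofReal (1 - q) • F s + ENNReal.ofReal q • F (x ::ₘ s))).sum := by
  have h1 := sub_nonneg.2 hq1
  rw [Multiset.powerset_cons, Multiset.map_add, Multiset.sum_add, Multiset.map_map,
    ← Multiset.sum_map_add]
  congr 1
  refine Multiset.map_congr rfl fun s hs => ?_
  have hle := Multiset.card_le_card (Multiset.mem_powerset.1 hs)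
  rw [smul_add, smul_smul, smul_smul, ← ENNReal.ofReal_mul (by positivity),
    ← ENNReal.ofReal_mul (by positivity), Function.comp_apply, Multiset.card_cons,
    Multiset.card_cons, Nat.add_sub_add_right, Nat.succ_sub hle,
    Nat.succ_eq_add_one, pow_succ, pow_succ]
  congr 3 <;> ac_rfl

theorem sum_powerset_weight {q : ℝ} (hq : 0 ≤ q) (hq1 : q ≤ 1) (D : Multiset X) :
    (D.powerset.map fun s =>
      ENNReal.ofReal (q ^ s.card * (1 - q) ^ (D.card - s.card))).sum = 1 := by
  induction D using Multiset.induction_on with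
  | empty => simp
  | cons x D ih =>
    have h := sum_powerset_cons hq hq1 x D fun _ => (1 : ℝ≥0∞)
    simp only [smul_eq_mul, mul_one] at h
    rw [h, ← ENNReal.ofReal_add (sub_nonneg.2 hq1) hq]
    simpa using ih

namespace Params

variable (A : Params K d X)

theorem measurable_gradient (f : Model d → ℝ) : Measurable (gradient f) :=
  (InnerProductSpace.toDual ℝ (Model d)).symm.continuous.measurable.comp (measurable_fderiv ℝ f)

theorem clippedSum_cons (w : Model d) (C : ℝ) (x : X) (s : Multiset X) :
    A.clippedSum w C (x ::ₘ s) =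
      clip C (gradient (fun v => A.trainLoss v x) w) + A.clippedSum w C s := by
  simp [clippedSum]

section Measurability

variable {Ω : Type*} [MeasurableSpace Ω] {w : Ω → Model d} {C σ : Ω → ℝ}

theorem measurable_clippedSum (hw : Measurable w) (hC : Measurable C) (s : Multiset X) :
    Measurable fun ω => A.clippedSum (w ω) (C ω) s := by
  induction s using Multiset.induction_on with
  | empty => simp [clippedSum]
  | cons x s ih =>
    simp_rw [clippedSum_cons]
    refine Measurable.add ?_ ih
    have hg : Measurable fun ω => gradient (fun v => A.trainLoss v x) (w ω) :=
      (measurable_gradient _).comp hw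
    unfold clip
    fun_prop

theorem measurable_clientLaw (q : ℝ) (D : Multiset X) (hw : Measurable w) (hC : Measurable C)
    (hσ : Measurable σ) : Measurable fun ω => A.clientLaw q (w ω) (C ω) (σ ω) D := by
  refine Measure.measurable_of_measurable_coe _ fun S hS => ?_
  simp_rw [clientLaw, multiset_sum_measure_apply, Measure.smul_apply, smul_eq_mul]
  refine measurable_multiset_sum _ _ fun s => Measurable.const_mul ?_ _
  have hc := A.measurable_clippedSum hw hC s
  have hm : Measurable fun x : Ω × Model d =>
      (1 / (A.L : ℝ)) • (A.clippedSum (w x.1) (C x.1) s + (σ x.1 * C x.1) • x.2) := by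
    have : Measurable fun x : Ω × Model d => A.clippedSum (w x.1) (C x.1) s := hc.comp measurable_fst
    fun_prop
  have e : ∀ ω, (stdGaussian (Model d)).map (fun z =>
      (1 / (A.L : ℝ)) • (A.clippedSum (w ω) (C ω) s + (σ ω * C ω) • z)) S =
      stdGaussian (Model d) (Prod.mk ω ⁻¹' ((fun x : Ω × Model d =>
      (1 / (A.L : ℝ)) • (A.clippedSum (w x.1) (C x.1) s + (σ x.1 * C x.1) • x.2)) ⁻¹' S)) :=
    fun ω => by rw [Measure.map_apply (by fun_prop) hS]; rfl
  simp_rw [e]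
  exact measurable_measure_prodMk_left (hm hS)

end Measurability

theorem isProbabilityMeasure_clientLaw {q : ℝ} (hq : 0 ≤ q) (hq1 : q ≤ 1) (w : Model d) (C σ : ℝ)
    (D : Multiset X) : IsProbabilityMeasure (A.clientLaw q w C σ D) := by
  refine ⟨?_⟩
  rw [clientLaw, multiset_sum_measure_apply, ← sum_powerset_weight hq hq1 D]
  congr 1
  refine Multiset.map_congr rfl fun s _ => ?_
  have : IsProbabilityMeasure ((stdGaussian (Model d)).map fun z =>
      (1 / (A.L : ℝ)) • (A.clippedSum w C s + (σ * C) • z)) :=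
    Measure.isProbabilityMeasure_map (by fun_prop)
  rw [Measure.smul_apply, measure_univ, smul_eq_mul, mul_one]

/-- In units of the noise level `σ C`, one clipped gradient has length at most `1/σ`. The shift does
not depend on the rest of the lot, so a single `u` serves all lots. -/
theorem exists_shift_clippedSum {C σ : ℝ} (hC : 0 ≤ C) (hσ : 0 < σ) (w : Model d) (x : X) :
    ∃ u : Model d, ‖u‖ ^ 2 / 2 ≤ 1 / (2 * σ ^ 2) ∧
      ∀ s, A.clippedSum w C (x ::ₘ s) = A.clippedSum w C s + (σ * C) • u := by
  have hclip := norm_clip_le hC (gradient (fun v => A.trainLoss v x) w)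
  rcases hC.eq_or_lt with rfl | hC
  -- A zero threshold removes the noise but also every clipped gradient, so the record has no
  -- influence.
  · refine ⟨0, by simpa using sq_nonneg _, fun s => ?_⟩
    rw [clippedSum_cons, norm_le_zero_iff.1 hclip]
    simp
  · refine ⟨(σ * C)⁻¹ • clip C (gradient (fun v => A.trainLoss v x) w), ?_, fun s => ?_⟩
    · rw [norm_smul, norm_inv, Real.norm_of_nonneg (by positivity)]
      have : (σ * C)⁻¹ * ‖clip C (gradient (fun v => A.trainLoss v x) w)‖ ≤ σ⁻¹ := by
        calc _ ≤ (σ * C)⁻¹ * C := by gcongr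
          _ = σ⁻¹ := by field_simp
      calc _ ≤ σ⁻¹ ^ 2 / 2 := by gcongr
        _ = _ := by field_simp
    · rw [clippedSum_cons, smul_inv_smul₀ (by positivity), add_comm]

variable {q p' : ℝ} {α : ℕ} {C σ : ℝ}

/-- Conditioning on the lot `s` drawn from `D` leaves an affine image of the pair `N(0, I)`, `(1 -
q) N(0, I) + q N(u, I)`. Averaging over `s` with the same weights on both sides preserves the
bounds. -/
theorem holderBound_clientLaw (hα : (α : ℝ).HolderConjugate p') (hq : 0 ≤ q) (hq1 : q ≤ 1)
    (hC : 0 ≤ C) (hσ : 0 < σ) (w : Model d) (x : X) (D : Multiset X) :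
    HolderBound α p' (ENNReal.ofReal (sampledMoment q (1 / (2 * σ ^ 2)) α))
      (A.clientLaw q w C σ (x ::ₘ D)) (A.clientLaw q w C σ D) ∧
    HolderBound α p' (ENNReal.ofReal (sampledMoment q (1 / (2 * σ ^ 2)) α))
      (A.clientLaw q w C σ D) (A.clientLaw q w C σ (x ::ₘ D)) := by
  obtain ⟨u, hu, hshift⟩ := A.exists_shift_clippedSum hC hσ w x
  have hmono := ENNReal.ofReal_le_ofReal (sampledMoment_mono hq hq1 hu α)
  set m := ENNReal.ofReal (sampledMoment q (1 / (2 * σ ^ 2)) α)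
  -- The lot weights sum to `1`, so the weighted bounds of the individual lots add up to `m`.
  have hm : (D.powerset.map fun s =>
      ENNReal.ofReal (q ^ s.card * (1 - q) ^ (D.card - s.card)) * m).sum = m := by
    rw [Multiset.sum_map_mul_right, sum_powerset_weight hq hq1, one_mul]
  have hmix : ∀ s, ENNReal.ofReal (1 - q) • ((stdGaussian (Model d)).map fun z =>
        (1 / (A.L : ℝ)) • (A.clippedSum w C s + (σ * C) • z)) +
      ENNReal.ofReal q • ((stdGaussian (Model d)).map fun z =>
        (1 / (A.L : ℝ)) • (A.clippedSum w C (x ::ₘ s) + (σ * C) • z)) =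
      (ENNReal.ofReal (1 - q) • stdGaussian (Model d) +
        ENNReal.ofReal q • (stdGaussian (Model d)).map (fun z => z + u)).map fun z =>
          (1 / (A.L : ℝ)) • (A.clippedSum w C s + (σ * C) • z) := fun s => by
    rw [Measure.map_add _ _ (by fun_prop), Measure.map_smul, Measure.map_smul,
      Measure.map_map (by fun_prop) (by fun_prop)]
    congr 3
    funext z
    rw [Function.comp_apply, hshift, smul_add (σ * C) z u, add_right_comm, add_assoc]
  have hcons : A.clientLaw q w C σ (x ::ₘ D) = (D.powerset.map fun s =>
      ENNReal.ofReal (q ^ s.card * (1 - q) ^ (D.card - s.card)) •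
      (ENNReal.ofReal (1 - q) • stdGaussian (Model d) +
        ENNReal.ofReal q • (stdGaussian (Model d)).map (fun z => z + u)).map fun z =>
          (1 / (A.L : ℝ)) • (A.clippedSum w C s + (σ * C) • z)).sum := by
    simp_rw [← hmix]
    exact sum_powerset_cons hq hq1 x D _
  rw [← hm, hcons, clientLaw]
  exact ⟨HolderBound.multiset_sum hα _ _ _ _ fun s _ =>
      (((holderBound_mixture_stdGaussian hα hq hq1 u).mono hα hmono).map (by fun_prop)).smul hα _,
    HolderBound.multiset_sum hα _ _ _ _ fun s _ =>
      (((holderBound_stdGaussian_mixture hα hq hq1 u).mono hα hmono).map (by fun_prop)).smul hα _⟩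

end Params

end

section

namespace Params

variable {K d : ℕ} {X : Type*} (A : Params K d X) (n : Fin K → ℕ)

/-! ### Models, thresholds and noise scales as functions of the transcript -/

theorem model_congr {y y' : Transcript K d} {t : ℕ} (h : ∀ s < t, y s = y' s) :
    A.model n y t = A.model n y' t := by
  induction t with
  | zero => rfl
  | succ t ih => simp only [model, ih fun s hs => h s (by omega), h t (by omega)]

theorem verif_congr {y y' : Transcript K d} {t : ℕ} (h : ∀ s < t, y s = y' s) :
    A.verif n y t = A.verif n y' t := by
  rw [verif, verif, A.model_congr n h]

theorem noiseScale_congr {y y' : Transcript K d} {t : ℕ} (h : ∀ s < t, y s = y' s) :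
    A.noiseScale n y t = A.noiseScale n y' t := by
  induction t with
  | zero => rfl
  | succ t ih =>
    simp only [noiseScale, ih fun s hs => h s (by omega),
      A.verif_congr n (t := t - 2) fun s hs => h s (by omega),
      A.verif_congr n (t := t - 1) fun s hs => h s (by omega),
      A.verif_congr n (t := t) fun s hs => h s (by omega), A.verif_congr n h]

theorem noiseScale_pos (hσ₀ : 0 < A.σ₀) (hβ₀ : 0 < A.β) (y : Transcript K d) (t : ℕ) :
    0 < A.noiseScale n y t := by
  induction t with
  | zero => exact hσ₀
  | succ t ih =>
    rw [noiseScale]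
    split_ifs
    · exact mul_pos hβ₀ ih
    · exact ih

theorem threshold_nonneg (hC₀ : ∀ j, 0 < A.C₀ j) (ha : 0 < A.clipFactor) (y : Transcript K d)
    (j : Fin K) (t : ℕ) : 0 ≤ A.threshold y j t := by
  cases t with
  | zero => exact (hC₀ j).le
  | succ t => exact mul_nonneg ha.le (norm_nonneg _)

theorem measurable_model (t : ℕ) : Measurable fun y : Transcript K d => A.model n y t := by
  induction t with
  | zero => exact measurable_const
  | succ t ih => simp only [model, localStep]; fun_prop

theorem measurable_threshold (j : Fin K) (t : ℕ) :
    Measurable fun y : Transcript K d => A.threshold y j t := by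
  cases t with
  | zero => exact measurable_const
  | succ t => simp only [threshold]; fun_prop

variable {A} in
theorem measurable_verif (hJ : Measurable A.verifLoss) (t : ℕ) :
    Measurable fun y : Transcript K d => A.verif n y t := by
  unfold verif
  split_ifs
  · exact measurable_const
  · exact (hJ.comp (A.measurable_model n t)).coe_real_ereal

variable {A} in
theorem measurable_noiseScale (hJ : Measurable A.verifLoss) (t : ℕ) :
    Measurable fun y : Transcript K d => A.noiseScale n y t := by
  induction t with
  | zero => exact measurable_const
  | succ t ih =>
    simp only [noiseScale]
    have hv := fun s => measurable_verif n hJ s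
    refine Measurable.ite ?_ (ih.const_mul _) ih
    exact (MeasurableSet.const _).inter ((measurableSet_lt (hv _) (hv _)).inter
      ((measurableSet_lt (hv _) (hv _)).inter (measurableSet_lt (hv _) (hv _))))

/-- The contribution of round `t` to `(α - 1)` times the privacy loss of client `k`. -/
def roundMoment (k : Fin K) (α : ℕ) (y : Transcript K d) (t : ℕ) : ℝ :=
  sampledMoment (A.rate (n k)) (1 / (2 * A.noiseScale n y t ^ 2)) α

theorem clientLoss_eq (k : Fin K) (α T : ℕ) (y : Transcript K d) :
    A.clientLoss n k α T y =
      ∑ t ∈ Finset.range (T + 1), 1 / ((α : ℝ) - 1) * A.roundMoment n k α y t +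
        Real.log (1 / A.δ) / ((α : ℝ) - 1) := by
  simp only [clientLoss, privacyLoss, roundMoment, sampledMoment, mul_one_div]

variable {A} in
theorem measurable_roundMoment (hJ : Measurable A.verifLoss) (k : Fin K) (α t : ℕ) :
    Measurable fun y : Transcript K d => A.roundMoment n k α y t := by
  have := measurable_noiseScale n hJ t
  unfold roundMoment sampledMoment
  fun_prop

theorem roundMoment_congr (k : Fin K) (α : ℕ) {y y' : Transcript K d} {t : ℕ}
    (h : ∀ s < t, y s = y' s) : A.roundMoment n k α y t = A.roundMoment n k α y' t := by
  rw [roundMoment, roundMoment, A.noiseScale_congr n h]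

/-! ### The laws of a round and of the transcript -/

variable {A} in
theorem measurableSet_halted (hJ : Measurable A.verifLoss) (t : ℕ) :
    MeasurableSet {y : Transcript K d | A.Halted n t y} := by
  have e : {y : Transcript K d | A.Halted n t y} =
      ⋃ j, ⋂ α ∈ A.orders, {y | A.budget < (A.clientLoss n j α t y : EReal)} := by
    ext y; simp [Halted]
  rw [e]
  refine MeasurableSet.iUnion fun j => MeasurableSet.biInter A.orders.countable_toSet fun α _ => ?_
  have hM := fun t => measurable_roundMoment n hJ j α t
  refine measurableSet_lt measurable_const (Measurable.coe_real_ereal ?_)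
  rw [show A.clientLoss n j α t = fun y => _ from funext (A.clientLoss_eq n j α t)]
  fun_prop

variable {n} (hq : ∀ j, 0 ≤ A.rate (n j)) (hq1 : ∀ j, A.rate (n j) ≤ 1) (D D' : Fin K → Multiset X)

include hq hq1

theorem isProbabilityMeasure_roundLaw (t : ℕ) (y : Transcript K d) :
    IsProbabilityMeasure (A.roundLaw n D t y) := by
  have := fun j => A.isProbabilityMeasure_clientLaw (hq j) (hq1 j) (A.model n y t)
    (A.threshold y j t) (A.noiseScale n y t) (D j)
  unfold roundLaw
  infer_instance

theorem measurable_roundLaw (hJ : Measurable A.verifLoss) (t : ℕ) :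
    Measurable (A.roundLaw n D t) := by
  have := A.isProbabilityMeasure_roundLaw hq hq1 D t
  have := fun y j => A.isProbabilityMeasure_clientLaw (hq j) (hq1 j) (A.model n y t)
    (A.threshold y j t) (A.noiseScale n y t) (D j)
  refine Measurable.measure_of_isPiSystem_of_isProbabilityMeasure generateFrom_pi.symm
    isPiSystem_pi ?_
  rintro _ ⟨s, hs, rfl⟩
  simp_rw [roundLaw, Measure.pi_pi]
  refine Finset.measurable_prod _ fun j _ => ?_
  have hsj : MeasurableSet (s j) := hs j (Set.mem_univ j)
  exact (Measure.measurable_coe hsj).comp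
    (A.measurable_clientLaw _ _ (A.measurable_model n t) (A.measurable_threshold j t)
      (measurable_noiseScale n hJ t))

omit hq hq1 in
theorem measurable_update_uncurry (t : ℕ) :
    Measurable fun x : Transcript K d × (Fin K → Model d) => Function.update x.1 t x.2 := by
  refine measurable_pi_iff.2 fun s => ?_
  rcases eq_or_ne s t with rfl | h
  · simpa using measurable_snd
  · simp_rw [Function.update_of_ne h]
    fun_prop

open Classical in
omit hq hq1 in
variable (n) in
/-- Law of the transcript after round `t`, given the transcript of the earlier rounds. -/
def stepLaw (t : ℕ) (y : Transcript K d) : Measure (Transcript K d) :=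
  if A.Halted n t y then Measure.dirac y
  else (A.roundLaw n D t y).map fun v => Function.update y t v

theorem measurable_stepLaw (hJ : Measurable A.verifLoss) (t : ℕ) :
    Measurable (A.stepLaw n D t) := by
  unfold stepLaw
  refine Measurable.ite (measurableSet_halted n hJ t) Measure.measurable_dirac ?_
  refine Measure.measurable_of_measurable_coe _ fun S hS => ?_
  have hu := measurable_update_uncurry (K := K) (d := d) t
  let κ : Kernel (Transcript K d) (Fin K → Model d) :=
    ⟨A.roundLaw n D t, A.measurable_roundLaw hq hq1 D hJ t⟩
  have : IsMarkovKernel κ := ⟨A.isProbabilityMeasure_roundLaw hq hq1 D t⟩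
  have e : ∀ y, (A.roundLaw n D t y).map (fun v => Function.update y t v) S = κ y (Prod.mk y ⁻¹'
      ((fun x : Transcript K d × (Fin K → Model d) => Function.update x.1 t x.2) ⁻¹' S)) :=
    fun y => by
      have hy : Measurable fun v => Function.update y t v := hu.comp measurable_prodMk_left
      rw [Measure.map_apply hy hS]; rfl
  simp_rw [e]
  exact Kernel.measurable_kernel_prodMk_left (hu hS)

theorem isProbabilityMeasure_stepLaw (t : ℕ) (y : Transcript K d) :
    IsProbabilityMeasure (A.stepLaw n D t y) := by
  have := A.isProbabilityMeasure_roundLaw hq hq1 D t y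
  unfold stepLaw
  split_ifs
  · infer_instance
  · exact Measure.isProbabilityMeasure_map
      ((measurable_update_uncurry t).comp measurable_prodMk_left).aemeasurable

theorem isProbabilityMeasure_law (hJ : Measurable A.verifLoss) (t : ℕ) :
    IsProbabilityMeasure (A.law n D t) := by
  induction t with
  | zero => rw [law]; infer_instance
  | succ t ih =>
    refine ⟨?_⟩
    have := A.isProbabilityMeasure_stepLaw hq hq1 D t
    change (A.law n D t).bind (A.stepLaw n D t) Set.univ = 1
    rw [Measure.bind_apply .univ (A.measurable_stepLaw hq hq1 D hJ t).aemeasurable]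
    simp

/-! ### Composition over the rounds -/

variable {k : Fin K} {α : ℕ} {p' : ℝ}

omit hq hq1 in
variable (n k α) in
/-- `exp (∑_{s < t} M_s / (α - 1))`, where `M_s` is the moment bound of round `s`. -/
def accumulatedWeight (t : ℕ) (y : Transcript K d) : ℝ≥0∞ :=
  ENNReal.ofReal (Real.exp (∑ s ∈ Finset.range t, 1 / ((α : ℝ) - 1) * A.roundMoment n k α y s))

omit hq hq1 in
theorem measurable_accumulatedWeight (hJ : Measurable A.verifLoss) (t : ℕ) :
    Measurable (A.accumulatedWeight n k α t) := by
  have := fun s => measurable_roundMoment n hJ k α s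
  unfold accumulatedWeight
  fun_prop

omit hq hq1 in
theorem accumulatedWeight_succ (t : ℕ) (y : Transcript K d) :
    A.accumulatedWeight n k α (t + 1) y = A.accumulatedWeight n k α t y *
      ENNReal.ofReal (Real.exp (1 / ((α : ℝ) - 1) * A.roundMoment n k α y t)) := by
  rw [accumulatedWeight, Finset.sum_range_succ, Real.exp_add,
    ENNReal.ofReal_mul (Real.exp_pos _).le, accumulatedWeight]

omit hq hq1 in
-- The last moment in the weight is that of round `t - 1`, whose noise scale only sees messages of
-- rounds before `t - 1`; hence the bound `s + 1 < t`.
theorem accumulatedWeight_congr {t : ℕ} {y y' : Transcript K d} (h : ∀ s, s + 1 < t → y s = y' s) :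
    A.accumulatedWeight n k α t y = A.accumulatedWeight n k α t y' := by
  unfold accumulatedWeight
  congr 2
  refine Finset.sum_congr rfl fun s hs => ?_
  rw [A.roundMoment_congr n k α fun r hr => h r (by have := Finset.mem_range.1 hs; omega)]

omit hq hq1 in
/-- The noise scales of the rounds up to `t` are not affected by the messages of round `t`. -/
theorem lintegral_stepLaw_mul_weight (hJ : Measurable A.verifLoss) (t : ℕ) (y : Transcript K d)
    {f : Transcript K d → ℝ≥0∞} (hf : Measurable f) :
    ∫⁻ z, f z * A.accumulatedWeight n k α (t + 1) z ∂(A.stepLaw n D t y) =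
      A.accumulatedWeight n k α (t + 1) y * ∫⁻ z, f z ∂(A.stepLaw n D t y) := by
  have hw := A.measurable_accumulatedWeight (n := n) (k := k) (α := α) hJ (t + 1)
  rw [← lintegral_const_mul _ hf]
  unfold stepLaw
  split_ifs
  · rw [lintegral_dirac' _ (by fun_prop), lintegral_dirac' _ (by fun_prop), mul_comm]
  · have hu : Measurable fun v => Function.update y t v :=
      (measurable_update_uncurry t).comp measurable_prodMk_left
    rw [lintegral_map (by fun_prop) hu, lintegral_map (by fun_prop) hu]
    refine lintegral_congr fun v => ?_
    rw [mul_comm, A.accumulatedWeight_congr (y' := y) fun s hs =>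
      Function.update_of_ne (by omega) _ _]

/-- Adaptive composition. The test function must be arbitrary, because the induction hypothesis is
applied to the bound for the integral over the last round, itself a function of the past. -/
theorem lintegral_law_le (hα : (α : ℝ).HolderConjugate p') (hJ : Measurable A.verifLoss)
    (h : ∀ t y, HolderBound α p' (ENNReal.ofReal (A.roundMoment n k α y t))
      (A.roundLaw n D t y) (A.roundLaw n D' t y))
    (t : ℕ) {f : Transcript K d → ℝ≥0∞} (hf : Measurable f) :
    ∫⁻ y, f y ∂(A.law n D t) ≤
      (∫⁻ y, f y ^ p' * A.accumulatedWeight n k α t y ∂(A.law n D' t)) ^ (1 / p') := by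
  have hp' := hα.symm.pos
  induction t generalizing f with
  | zero =>
    have hw := A.measurable_accumulatedWeight (n := n) (k := k) (α := α) hJ 0
    rw [law, law, lintegral_dirac' _ hf, lintegral_dirac' _ (by fun_prop), accumulatedWeight]
    simp only [Finset.range_zero, Finset.sum_empty, Real.exp_zero, ENNReal.ofReal_one, mul_one]
    rw [← ENNReal.rpow_mul, mul_one_div_cancel hp'.ne', ENNReal.rpow_one]
  | succ t ih =>
    have hm := A.measurable_stepLaw hq hq1 D hJ t
    have hm' := A.measurable_stepLaw hq hq1 D' hJ t
    have hw := fun t => A.measurable_accumulatedWeight (n := n) (k := k) (α := α) hJ t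
    have hM := measurable_roundMoment n hJ k α t
    have hfw : Measurable fun y => f y ^ p' * A.accumulatedWeight n k α (t + 1) y :=
      (hf.pow_const _).mul (hw (t + 1))
    -- `F ^ (1 / p')` bounds the integral over the last round. Using it as test function for the
    -- earlier rounds cancels the root and multiplies the weight by the factor of round `t`.
    set F : Transcript K d → ℝ≥0∞ := fun y =>
      ENNReal.ofReal (Real.exp (1 / ((α : ℝ) - 1) * A.roundMoment n k α y t)) *
        ∫⁻ z, f z ^ p' ∂(A.stepLaw n D' t y) with hF
    have hFm : Measurable F := by
      have := (Measure.measurable_lintegral (hf.pow_const p')).comp hm'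
      exact Measurable.mul (by fun_prop) this
    have hstep : ∀ y, ∫⁻ z, f z ∂(A.stepLaw n D t y) ≤ F y ^ (1 / p') := fun y => by
      have hone : 1 ≤ A.roundMoment n k α y t :=
        one_le_sampledMoment (hq k) (hq1 k) (by positivity) α
      have hb : HolderBound α p' (ENNReal.ofReal (A.roundMoment n k α y t))
          (A.stepLaw n D t y) (A.stepLaw n D' t y) := by
        unfold stepLaw
        split_ifs
        -- After an interruption both step laws are the same Dirac mass, with constant `1`; the
        -- round is still charged its moment, which is at least `1`.
        · refine (HolderBound.refl hα _).mono hα ?_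
          rw [measure_univ]
          exact ENNReal.one_le_ofReal.2 hone
        · exact (h t y).map ((measurable_update_uncurry t).comp measurable_prodMk_left)
      refine (hb f hf).trans ?_
      rw [hF, ENNReal.mul_rpow_of_nonneg _ _ (one_div_pos.2 hp').le]
      gcongr
      have hα0 := hα.pos
      rw [ENNReal.ofReal_rpow_of_pos (Real.exp_pos _),
        ENNReal.ofReal_rpow_of_pos (by linarith)]
      refine ENNReal.ofReal_le_ofReal ?_
      -- `M ≤ exp M`, and `1 / α = (1 / (α - 1)) (1 / p')` since `p' = α / (α - 1)`.
      calc A.roundMoment n k α y t ^ (1 / (α : ℝ))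
          ≤ Real.exp (A.roundMoment n k α y t) ^ (1 / (α : ℝ)) := by
            have := Real.add_one_le_exp (A.roundMoment n k α y t)
            gcongr
            linarith
        _ = _ := by
            have h1 := hα.sub_one_pos.ne'
            rw [← Real.exp_mul, ← Real.exp_mul, hα.conjugate_eq]
            congr 1
            field_simp
    change ∫⁻ y, f y ∂((A.law n D t).bind (A.stepLaw n D t)) ≤
      (∫⁻ y, f y ^ p' * A.accumulatedWeight n k α (t + 1) y
        ∂((A.law n D' t).bind (A.stepLaw n D' t))) ^ (1 / p')
    rw [Measure.lintegral_bind hm.aemeasurable hf.aemeasurable,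
      Measure.lintegral_bind hm'.aemeasurable hfw.aemeasurable]
    refine (lintegral_mono hstep).trans ((ih (hFm.pow_const _)).trans ?_)
    gcongr with y
    rw [← ENNReal.rpow_mul, one_div_mul_cancel hp'.ne', ENNReal.rpow_one,
      A.lintegral_stepLaw_mul_weight D' hJ t y (hf.pow_const _), accumulatedWeight_succ, hF]
    exact le_of_eq (by ring)

/-! ### From moments to `(ε, δ)` -/

theorem law_lt (hα : (α : ℝ).HolderConjugate p') (hJ : Measurable A.verifLoss)
    (h : ∀ t y, HolderBound α p' (ENNReal.ofReal (A.roundMoment n k α y t))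
      (A.roundLaw n D t y) (A.roundLaw n D' t y))
    (hδ₀ : 0 < A.δ) {R T : ℕ} (hR : R ≤ T + 1)
    {S : Set (Transcript K d)} (hS : MeasurableSet S) :
    A.law n D R S < ∫⁻ y in S, ENNReal.ofReal (Real.exp (A.clientLoss n k α T y)) ∂(A.law n D' R) +
      ENNReal.ofReal A.δ := by
  have := A.isProbabilityMeasure_law hq hq1 D hJ R
  have hp' := hα.symm.pos
  have hα0 := hα.pos
  have h1 := hα.sub_one_pos
  set I := ∫⁻ y in S, ENNReal.ofReal (Real.exp (A.clientLoss n k α T y)) ∂(A.law n D' R) with hI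
  rcases eq_or_ne I ⊤ with hI_top | hI_top
  -- Infinite `I` is treated apart because strictness is later obtained by adding a finite term.
  · rw [hI_top, top_add]
    exact measure_lt_top _ _
  -- The factor in `δ` cancels the term `log (1 / δ) / (α - 1)` of the loss; moments of rounds from
  -- `R` to `T` are nonnegative and only enlarge the right side.
  have hweight : ∀ y, A.accumulatedWeight n k α R y ≤ ENNReal.ofReal (A.δ ^ (1 / ((α : ℝ) - 1))) *
      ENNReal.ofReal (Real.exp (A.clientLoss n k α T y)) := fun y => by
    rw [← ENNReal.ofReal_mul (by positivity), Real.rpow_def_of_pos hδ₀, ← Real.exp_add,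
      accumulatedWeight]
    refine ENNReal.ofReal_le_ofReal (Real.exp_le_exp.2 ?_)
    have hsum : ∑ s ∈ Finset.range R, 1 / ((α : ℝ) - 1) * A.roundMoment n k α y s ≤
        ∑ s ∈ Finset.range (T + 1), 1 / ((α : ℝ) - 1) * A.roundMoment n k α y s :=
      Finset.sum_le_sum_of_subset_of_nonneg (Finset.range_mono hR) fun s _ _ =>
        mul_nonneg (by positivity) (sampledMoment_nonneg (hq k) (hq1 k) _ _)
    refine hsum.trans (le_of_eq ?_)
    rw [clientLoss_eq, one_div A.δ, Real.log_inv]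
    ring
  have hbound : A.law n D R S ≤ ENNReal.ofReal A.δ ^ (1 / (α : ℝ)) * I ^ (1 / p') := by
    have hpow : ∀ y, S.indicator (1 : Transcript K d → ℝ≥0∞) y ^ p' *
        A.accumulatedWeight n k α R y = S.indicator (A.accumulatedWeight n k α R) y := fun y => by
      by_cases hy : y ∈ S <;> simp [hy, hp']
    have hL := A.lintegral_law_le hq hq1 D D' hα hJ h R (measurable_one.indicator hS)
    rw [lintegral_indicator_one hS] at hL
    simp_rw [hpow] at hL
    rw [lintegral_indicator hS] at hL
    refine hL.trans ?_
    calc _ ≤ (ENNReal.ofReal (A.δ ^ (1 / ((α : ℝ) - 1))) * I) ^ (1 / p') := by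
          gcongr
          rw [hI, ← lintegral_const_mul' _ _ ENNReal.ofReal_ne_top]
          exact lintegral_mono fun y => hweight y
      _ = _ := by
          rw [ENNReal.mul_rpow_of_nonneg _ _ (one_div_pos.2 hp').le,
            ENNReal.ofReal_rpow_of_pos (by positivity), ENNReal.ofReal_rpow_of_pos hδ₀,
            ← Real.rpow_mul hδ₀.le, hα.conjugate_eq]
          congr 3
          field_simp
  -- Young's inequality gives `δ / α + I / p'`; strictness comes from `δ / α < δ`.
  refine hbound.trans_lt ((ENNReal.young_inequality _ _ hα).trans_lt ?_)
  rw [← ENNReal.rpow_mul, ← ENNReal.rpow_mul, one_div_mul_cancel hα0.ne',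
    one_div_mul_cancel hp'.ne', ENNReal.rpow_one, ENNReal.rpow_one, add_comm,
    ← ENNReal.ofReal_div_of_pos hα0]
  refine ENNReal.add_lt_add_of_le_of_lt ?_ ?_ ?_
  · exact (ENNReal.div_lt_top hI_top (ENNReal.ofReal_pos.2 hp').ne').ne
  · refine ENNReal.div_le_of_le_mul (le_mul_of_one_le_right' ?_)
    exact ENNReal.one_le_ofReal.2 hα.symm.lt.le
  · exact (ENNReal.ofReal_lt_ofReal_iff hδ₀).2 (div_lt_self hδ₀ hα.lt)

/-- Given the same past, only the factor of client `k` differs between the two product laws. Both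
directions of the client bound have the same constant, so adding and removing a record are covered
alike. -/
theorem holderBound_roundLaw (hα : (α : ℝ).HolderConjugate p') (hC₀ : ∀ j, 0 < A.C₀ j)
    (hσ₀ : 0 < A.σ₀) (ha : 0 < A.clipFactor) (hβ₀ : 0 < A.β) (hD' : AdjacentAt k D D')
    (t : ℕ) (y : Transcript K d) :
    HolderBound α p' (ENNReal.ofReal (A.roundMoment n k α y t))
      (A.roundLaw n D t y) (A.roundLaw n D' t y) ∧
    HolderBound α p' (ENNReal.ofReal (A.roundMoment n k α y t))
      (A.roundLaw n D' t y) (A.roundLaw n D t y) := by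
  have hprob := fun D j => A.isProbabilityMeasure_clientLaw (hq j) (hq1 j) (A.model n y t)
    (A.threshold y j t) (A.noiseScale n y t) D
  have hC := A.threshold_nonneg hC₀ ha y k t
  have hσ := A.noiseScale_pos n hσ₀ hβ₀ y t
  obtain ⟨⟨x, hx⟩, hne⟩ := hD'
  have hb := A.holderBound_clientLaw hα (hq k) (hq1 k) hC hσ (A.model n y t) x
  refine ⟨HolderBound.pi hα k _ _ ?_ fun j hj => by rw [hne j hj],
    HolderBound.pi hα k _ _ ?_ fun j hj => by rw [hne j hj]⟩
  · rcases hx with hx | hx <;> rw [hx]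
    exacts [(hb _).2, (hb _).1]
  · rcases hx with hx | hx <;> rw [hx]
    exacts [(hb _).1, (hb _).2]

end Params

end

end AdapDPFL

end

/-! ### From adaptive to constant privacy loss, and the final theorem -/

theorem AdapDPFL.DPBoundAdaptive.dpBound {Y : Type*} [MeasurableSpace Y] {P Q : Measure Y}
    {ε : Y → ℝ} {δ ε' : ℝ} (h : AdapDPFL.DPBoundAdaptive P Q ε δ)
    (hP : ∀ᵐ y ∂P, ε y ≤ ε') (hQ : ∀ᵐ y ∂Q, ε y ≤ ε') : AdapDPFL.DPBound P Q ε' δ := by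
  have key : ∀ (μ : Measure Y) (S : Set Y), (∀ᵐ y ∂μ, ε y ≤ ε') →
      ∫⁻ y in S, ENNReal.ofReal (Real.exp (ε y)) ∂μ ≤ ENNReal.ofReal (Real.exp ε') * μ S :=
    fun μ S hμ => by
      rw [← setLIntegral_const]
      refine lintegral_mono_ae ((ae_restrict_of_ae hμ).mono fun y hy => ?_)
      exact ENNReal.ofReal_le_ofReal (Real.exp_le_exp.2 hy)
  exact fun S hS => ⟨(h S hS).1.trans_le (add_le_add_left (key Q S hQ) _),
    (h S hS).2.trans_le (add_le_add_left (key P S hP) _)⟩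

theorem theorem1 {K d : ℕ} {X : Type*} (A : AdapDPFL.Params K d X)
    (hJ : Measurable A.verifLoss)
    (hC₀ : ∀ j, 0 < A.C₀ j) (hσ₀ : 0 < A.σ₀) (ha : 0 < A.clipFactor)
    (hβ₀ : 0 < A.β) (hβ₁ : A.β < 1) (hδ₀ : 0 < A.δ) (hδ₁ : A.δ < 1) (hL : 0 < A.L)
    -- the local datasets; the public sizes are `n j = |D j|`
    (D : Fin K → Multiset X) (n : Fin K → ℕ) (hn : ∀ j, n j = (D j).card) (hLn : ∀ j, A.L ≤ n j)
    -- a neighbouring collection of datasets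
    (k : Fin K) (D' : Fin K → Multiset X) (hD' : AdapDPFL.AdjacentAt k D D')
    (α : ℕ) (hα : 2 ≤ α)
    -- the run consists of the rounds `0, …, T - 1` or of the rounds `0, …, T`
    (T R : ℕ) (hR : R = T ∨ R = T + 1) :
    AdapDPFL.DPBoundAdaptive (A.law n D R) (A.law n D' R) (A.clientLoss n k α T) A.δ ∧
    ∀ ε : ℝ,
      (∀ᵐ y ∂(A.law n D R), A.clientLoss n k α T y ≤ ε) →
      (∀ᵐ y ∂(A.law n D' R), A.clientLoss n k α T y ≤ ε) →
      AdapDPFL.DPBound (A.law n D R) (A.law n D' R) ε A.δ := by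
  have hq : ∀ j, 0 ≤ A.rate (n j) := fun j => by unfold AdapDPFL.Params.rate; positivity
  have hq1 : ∀ j, A.rate (n j) ≤ 1 := fun j =>
    div_le_one_of_le₀ (by exact_mod_cast hLn j) (Nat.cast_nonneg _)
  have hα' : (α : ℝ).HolderConjugate ((α : ℝ).conjExponent) :=
    .conjExponent (by exact_mod_cast (show 1 < α by omega))
  have hR' : R ≤ T + 1 := by omega
  have hround := A.holderBound_roundLaw hq hq1 D D' hα' hC₀ hσ₀ ha hβ₀ hD'
  have main : AdapDPFL.DPBoundAdaptive (A.law n D R) (A.law n D' R) (A.clientLoss n k α T) A.δ :=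
    fun S hS =>
      ⟨A.law_lt hq hq1 D D' hα' hJ (fun t y => (hround t y).1) hδ₀ hR' hS,
        A.law_lt hq hq1 D' D hα' hJ (fun t y => (hround t y).2) hδ₀ hR' hS⟩
  exact ⟨main, fun ε hP hQ => main.dpBound hP hQ⟩
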